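/- Let $(X,\mu)$ be a standard (nonatomic) Lebesgue probability space and let $T$ be a rank-one measure-preserving transformation of $(X,\mu)$, that is, $T$ is invertible almost everywhere with measure-preserving inverse and there are integers $r_n>1$ ($n\in\mathbb N=\{0,1,2,\dots\}$) and $s_{n,i}\ge 0$ ($0<i\le r_n$) such that, with $h_0=1$ and $h_{n+1}=r_nh_n+\sum_{0<i\le r_n}s_{n,i}$, one has $\sum_n (h_{n+1}-r_nh_n)/h_{n+1}<\infty$, and there are measurable sets $B_n$, $B_{n,i}$ ($0<i\le r_n$), $C_{n,i,j}$ ($0<i\le r_n$, $0<j\le s_{n,i}$) such that, for all $n$ and up to null sets: $\{B_{n,i}:0<i\le r_n\}$ is a partition of $B_n$; the levels $T^k(B_n)$, $0\le k<h_n$, are disjoint; $T^{h_n}(B_{n,i})=C_{n,i,1}$ if $s_{n,i}\ne 0$; $T^{h_n}(B_{n,i})=B_{n,i+1}$ if $s_{n,i}=0$ and $i<r_n$; $T(C_{n,i,j})=C_{n,i,j+1}$ if $j<s_{n,i}$; $T(C_{n,i,s_{n,i}})=B_{n,i+1}$ if $i<r_n$ and $s_{n,i}\neq 0$; $B_{n+1}=B_{n,1}$;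 and, finally, every measurable set can be approximated in measure arbitrarily well by unions of levels of the stage-$n$ towers $\{T^k(B_n):0\le k<h_n\}$ as $n$ varies. Fix such data, and for $n\ge m$ let $$I_{m,n}=\{i: 0\le i<h_n,\ T^i(B_n)\subseteq B_m\}.$$ Let $(k_n)_{n\in\mathbb N}$ be integers greater than $1$ with $k_n\mid k_{n+1}$ for all $n$, such that the set $K=\{m\in\mathbb N:\exists n\ (m\mid k_n)\}$ is infinite. Let $\mathcal O_K$ be the corresponding odometer: the map $(\alpha_n)\mapsto(\alpha_n+1)$ on the set of all $(\alpha_n)\in\prod_n\mathbb Z/k_n\mathbb Z$ with $\alpha_n\equiv\alpha_m \pmod{k_m}$ for all $m\le n$, with the probability measure that gives each set $\{\alpha:\alpha_n=i\}$ measure $1/k_n$. For $k\in K$, write $[i]_k$ for the residue class of $i$ modulo $k$. The following are equivalent. (I) $T$ is isomorphic to $\mathcal O_K$, that is, there is a measure-preserving, almost everywhere invertible map that intertwines the two transformations almost everywhere. (II) Both of the following hold. (IIa) For all $k\in K$ and all $\eta>0$ there is $N\in\mathbb N$ such that for all $n\ge m\ge N$ there is $j\in\mathbb Z/k\mathbb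 Z$ with $$\frac{|\{i\in I_{m,n}:[i]_k\ne j\}|}{|I_{m,n}|}<\eta.$$ (IIb) For all $l\in\mathbb N$ and all $\epsilon>0$ there are $k\in K$ and $N\ge l$ such that for all $m\ge N$ there is $D\subseteq\mathbb Z/k\mathbb Z$ with $$\frac{|\{0\le i\le h_m:[i]_k\in D\}\,\Delta\, I_{l,m}|}{|I_{l,m}|}<\epsilon.$$ -/

import Mathlib

open MeasureTheory Filter Topology
open scoped ENNReal symmDiff

/-- A (finite) measure-preserving transformation: a measure-preserving map that is invertible on a
set of full measure, with measure-preserving inverse. The map and its inverse are extended to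
total functions; the inverse is unique up to null sets. -/
structure MPTransformation {X : Type*} [MeasurableSpace X] (μ : Measure X) where
  toFun : X → X
  invFun : X → X
  measurePreserving : MeasurePreserving toFun μ μ
  measurePreserving_inv : MeasurePreserving invFun μ μ
  left_inv : ∀ᵐ x ∂μ, invFun (toFun x) = x
  right_inv : ∀ᵐ x ∂μ, toFun (invFun x) = x

namespace MPTransformation

variable {X : Type*} [MeasurableSpace X] {μ : Measure X}
variable {Y : Type*} [MeasurableSpace Y] {ν : Measure Y}

/-- The forward image `T ^ k (A)`, as an element of the measure algebra: it is represented by the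
preimage of `A` under the `k`-th iterate of the inverse of `T`. (The set-theoretic image under a
map that is only invertible almost everywhere may change by more than a null set if `A` is changed
by a null set; the preimage under the inverse does not have this defect.) -/
def image (T : MPTransformation μ) (k : ℕ) (A : Set X) : Set X :=
  (T.invFun^[k]) ⁻¹' A

/-- `φ` is a factor map from `T` to `S`. -/
def IsFactorMap (T : MPTransformation μ) (S : MPTransformation ν) (φ : X → Y) : Prop :=
  MeasurePreserving φ μ ν ∧ ∀ᵐ x ∂μ, φ (T.toFun x) = S.toFun (φ x)

/-- `T` and `S` are isomorphic: there is a factor map from `T` to `S` which is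
invertible almost everywhere. -/
def Isomorphic (T : MPTransformation μ) (S : MPTransformation ν) : Prop :=
  ∃ (φ : X → Y) (ψ : Y → X), T.IsFactorMap S φ ∧ MeasurePreserving ψ ν μ ∧
    (∀ᵐ x ∂μ, ψ (φ x) = x) ∧ (∀ᵐ y ∂ν, φ (ψ y) = y)

end MPTransformation

/-- The heights `h 0 = 1`, `h (n + 1) = r n * h n + ∑_{0 < i ≤ r n} s n i` of the towers determined
by the cutting parameter `r` and the spacer parameter `s`. -/
def rankOneHeight (r : ℕ → ℕ) (s : ℕ → ℕ → ℕ) : ℕ → ℕ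
  | 0 => 1
  | n + 1 => r n * rankOneHeight r s n + ∑ i ∈ Finset.Icc 1 (r n), s n i

/-- A presentation of `T` as a rank-one transformation by cutting and stacking: a cutting
parameter `r`, a spacer parameter `s` (`s n i` matters only for `0 < i ≤ r n`), and sets
`B n`, `Bsub n i` (`0 < i ≤ r n`), `C n i j` (`0 < i ≤ r n`, `0 < j ≤ s n i`).
All relations between sets are understood up to null sets. -/
structure RankOnePresentation {X : Type*} [MeasurableSpace X] {μ : Measure X}
    (T : MPTransformation μ) where
  r : ℕ → ℕ
  s : ℕ → ℕ → ℕ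
  B : ℕ → Set X
  Bsub : ℕ → ℕ → Set X
  C : ℕ → ℕ → ℕ → Set X
  one_lt_r : ∀ n, 1 < r n
  summable_spacers : Summable fun n : ℕ =>
    ((rankOneHeight r s (n + 1) : ℝ) - r n * rankOneHeight r s n) / rankOneHeight r s (n + 1)
  measurable_B : ∀ n, NullMeasurableSet (B n) μ
  measurable_Bsub : ∀ n, ∀ i ∈ Finset.Icc 1 (r n), NullMeasurableSet (Bsub n i) μ
  measurable_C : ∀ n, ∀ i ∈ Finset.Icc 1 (r n), ∀ j ∈ Finset.Icc 1 (s n i),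
    NullMeasurableSet (C n i j) μ
  /-- `{Bsub n i : 0 < i ≤ r n}` is a partition of `B n`. -/
  iUnion_Bsub : ∀ n, (⋃ i ∈ Finset.Icc 1 (r n), Bsub n i) =ᵐ[μ] B n
  disjoint_Bsub : ∀ n, ∀ i ∈ Finset.Icc 1 (r n), ∀ j ∈ Finset.Icc 1 (r n), i ≠ j →
    AEDisjoint μ (Bsub n i) (Bsub n j)
  /-- The levels of the stage-`n` tower are disjoint. -/
  disjoint_levels : ∀ n, ∀ a < rankOneHeight r s n, ∀ b < rankOneHeight r s n, a ≠ b →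
    AEDisjoint μ (T.image a (B n)) (T.image b (B n))
  image_Bsub_of_ne_zero : ∀ n, ∀ i ∈ Finset.Icc 1 (r n), s n i ≠ 0 →
    T.image (rankOneHeight r s n) (Bsub n i) =ᵐ[μ] C n i 1
  image_Bsub_of_eq_zero : ∀ n, ∀ i ∈ Finset.Icc 1 (r n), i < r n → s n i = 0 →
    T.image (rankOneHeight r s n) (Bsub n i) =ᵐ[μ] Bsub n (i + 1)
  image_C : ∀ n, ∀ i ∈ Finset.Icc 1 (r n), ∀ j ∈ Finset.Icc 1 (s n i), j < s n i →
    T.image 1 (C n i j) =ᵐ[μ] C n i (j + 1)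
  image_C_last : ∀ n, ∀ i ∈ Finset.Icc 1 (r n), i < r n → s n i ≠ 0 →
    T.image 1 (C n i (s n i)) =ᵐ[μ] Bsub n (i + 1)
  B_succ : ∀ n, B (n + 1) =ᵐ[μ] Bsub n 1
  /-- The levels of the towers are dense in the `σ`-algebra: every measurable set is approximated
  arbitrarily well by a union of levels of one of the towers. -/
  dense_levels : ∀ A : Set X, MeasurableSet A → ∀ ε : ℝ≥0∞, 0 < ε →
    ∃ n, ∃ J ⊆ Finset.range (rankOneHeight r s n), μ (A ∆ ⋃ i ∈ J, T.image i (B n)) < ε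

namespace RankOnePresentation

variable {X : Type*} [MeasurableSpace X] {μ : Measure X} {T : MPTransformation μ}

/-- The height of the stage-`n` tower. -/
def h (P : RankOnePresentation T) (n : ℕ) : ℕ := rankOneHeight P.r P.s n

open scoped Classical in
/-- `I m n` is the set of indices of those levels of the stage-`n` tower that are contained in the
base `B m` of the stage-`m` tower. -/
noncomputable def I (P : RankOnePresentation T) (m n : ℕ) : Finset ℕ :=
  {i ∈ Finset.range (P.h n) | T.image i (P.B n) ≤ᵐ[μ] P.B m}

end RankOnePresentation

/-- A sequence of integers greater than one, each of which divides the next one. -/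
structure OdometerSequence where
  k : ℕ → ℕ
  one_lt : ∀ n, 1 < k n
  dvd_succ : ∀ n, k n ∣ k (n + 1)

namespace OdometerSequence

variable (κ : OdometerSequence)

instance (n : ℕ) : NeZero (κ.k n) := ⟨(Nat.zero_lt_of_lt (κ.one_lt n)).ne'⟩

theorem dvd {m n : ℕ} (h : m ≤ n) : κ.k m ∣ κ.k n :=
  Nat.le_induction dvd_rfl (fun n _ ih => ih.trans (κ.dvd_succ n)) n h

/-- The set of all factors of the terms of the sequence. -/
def factors : Set ℕ := {m | ∃ n, m ∣ κ.k n}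

/-- The space of the odometer: all sequences `α ∈ ∏ n, ℤ/k_n` with `α_n ≡ α_m` modulo `k_m`
whenever `m ≤ n`, as a subgroup of the product. -/
def space : AddSubgroup (∀ n, ZMod (κ.k n)) where
  carrier := {α | ∀ (m n : ℕ) (h : m ≤ n), ZMod.castHom (κ.dvd h) (ZMod (κ.k m)) (α n) = α m}
  zero_mem' := fun m n h => by simp only [Pi.zero_apply, map_zero]
  add_mem' := fun {a b} ha hb m n h => by
    simp only [Pi.add_apply, map_add]; rw [ha m n h, hb m n h]
  neg_mem' := fun {a} ha m n h => by
    simp only [Pi.neg_apply, map_neg]; rw [ha m n h]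

theorem isClosed_space : IsClosed (κ.space : Set (∀ n, ZMod (κ.k n))) := by
  have : (κ.space : Set (∀ n, ZMod (κ.k n))) = ⋂ (m : ℕ) (n : ℕ) (h : m ≤ n),
      {α | ZMod.castHom (κ.dvd h) (ZMod (κ.k m)) (α n) = α m} := by
    ext α; simp [space]
  rw [this]
  refine isClosed_iInter fun m => isClosed_iInter fun n => isClosed_iInter fun h => ?_
  exact isClosed_eq (continuous_of_discreteTopology.comp (continuous_apply n)) (continuous_apply m)

instance : CompactSpace κ.space := isCompact_iff_compactSpace.mp κ.isClosed_space.isCompact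


/-- The sequence `(1, 1, 1, …)`. -/
def one : κ.space := ⟨fun _ => 1, fun m _ h => map_one (ZMod.castHom (κ.dvd h) (ZMod (κ.k m)))⟩

/-- The natural measure on the odometer, that is, its normalized Haar measure. It is the unique
measure which gives every set `{α | α_n = i}` the measure `1 / k_n`
(see `measure_cylinder`). -/
noncomputable def measure : Measure κ.space :=
  Measure.addHaarMeasure (⊤ : TopologicalSpace.PositiveCompacts κ.space)

instance : Measure.IsAddHaarMeasure κ.measure := by
  unfold measure; infer_instance

instance : IsProbabilityMeasure κ.measure :=
  ⟨by
    have h := Measure.addHaarMeasure_self (K₀ := (⊤ : TopologicalSpace.PositiveCompacts κ.space))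
    rwa [TopologicalSpace.PositiveCompacts.coe_top] at h⟩

theorem measure_cylinder (n : ℕ) (i : ZMod (κ.k n)) :
    κ.measure {α | (α : ∀ n, ZMod (κ.k n)) n = i} = (κ.k n : ℝ≥0∞)⁻¹ := by
  have hm : ∀ j : ZMod (κ.k n),
      MeasurableSet {α : κ.space | (α : ∀ n, ZMod (κ.k n)) n = j} := fun j =>
    measurableSet_eq_fun ((measurable_pi_apply n).comp measurable_subtype_coe) measurable_const
  have hone : ∀ a : ℕ, ((a • κ.one : κ.space) : ∀ n, ZMod (κ.k n)) n = a := fun a => by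
    simp [one]
  have hc : ∀ j : ZMod (κ.k n), κ.measure {α | (α : ∀ n, ZMod (κ.k n)) n = j} =
      κ.measure {α | (α : ∀ n, ZMod (κ.k n)) n = 0} := fun j => by
    rw [← measure_preimage_add κ.measure (j.val • κ.one) {α | (α : ∀ n, ZMod (κ.k n)) n = j}]
    congr 1
    ext α
    have := hone j.val
    simp only [Set.mem_preimage, Set.mem_ofPred_eq, AddSubgroup.coe_add, Pi.add_apply, this,
      ZMod.natCast_zmod_val, add_eq_left]
  have hsum : ∑ j : ZMod (κ.k n), κ.measure {α | (α : ∀ n, ZMod (κ.k n)) n = j} = 1 := by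
    rw [← measure_univ (μ := κ.measure), ← measure_biUnion_finset]
    · congr 1
      ext α
      simp
    · intro a _ b _ hab
      exact Set.disjoint_left.mpr fun α ha hb => hab (ha.symm.trans hb)
    · exact fun j _ => hm j
  rw [hc i]
  simp only [hc, Finset.sum_const, Finset.card_univ, ZMod.card, nsmul_eq_mul] at hsum
  exact ENNReal.eq_inv_of_mul_eq_one_left (by rwa [mul_comm])

/-- The odometer given by the sequence `κ`: the map `(α_n) ↦ (α_n + 1)`, with its natural
measure. -/
noncomputable def odometer : MPTransformation κ.measure where
  toFun := fun α => α + κ.one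
  invFun := fun α => α - κ.one
  measurePreserving := measurePreserving_add_right κ.measure κ.one
  measurePreserving_inv := measurePreserving_sub_right κ.measure κ.one
  left_inv := Eventually.of_forall fun α => add_sub_cancel_right α κ.one
  right_inv := Eventually.of_forall fun α => sub_add_cancel α κ.one

end OdometerSequence

/-!
Let `index n x` be the index of the stage-`n` level that contains `x`. Modulo `k` it intertwines `T`
with the rotation of `ℤ/kℤ`, except off the tower and on its top level. If `f` is a genuine factor
map from `T` onto this rotation, then approximating `f` by a function of `index n` shows that `f` is
nearly constant on `base n`, so `f` is close to `index n + j` for a constant `j`. As the copies of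
`base n` in `base m` have the indices `I m n`, this gives (IIa), and it turns (IIb) into the
statement that `base l` is approximated by preimages under factor maps `f`. If `T` is isomorphic to
the odometer, every measurable set is approximated in this way, by preimages of cylinders.

Conversely, (IIa) says that for large `m ≤ n` the functions `index m` and `index n` differ modulo
`k` by a constant up to a small set. Along a fast subsequence, with these constants subtracted, the
indices converge almost everywhere in the odometer, by Borel–Cantelli. The limit is a factor map,
and by (IIb) all levels, hence all measurable sets, are preimages up to null sets; in a standard
Borel space this makes the factor map invertible almost everywhere.
-/

theorem measureReal_mono_ae {X : Type*} [MeasurableSpace X] {μ : Measure X} [IsFiniteMeasure μ]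
    {A B : Set X} (h : A ≤ᵐ[μ] B) : μ.real A ≤ μ.real B :=
  ENNReal.toReal_mono (measure_ne_top μ B) (measure_mono_ae h)

theorem ae_eventually_notMem_of_measureReal_le_geometric {X : Type*} [MeasurableSpace X]
    {μ : Measure X} [IsFiniteMeasure μ] {E : ℕ → Set X} (hE : ∀ t, μ.real (E t) ≤ (1 / 2) ^ t) :
    ∀ᵐ x ∂μ, ∀ᶠ t in atTop, x ∉ E t := by
  refine ae_eventually_notMem (ne_top_of_le_ne_top summable_geometric_two.tsum_ofReal_ne_top
    (ENNReal.tsum_le_tsum fun t => ?_))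
  rw [← ofReal_measureReal]
  exact ENNReal.ofReal_le_ofReal (hE t)

theorem eventuallyMeasurableSet_of_approx {X : Type*} {m mX : MeasurableSpace X} {μ : Measure X}
    [IsFiniteMeasure μ] {A : Set X}
    (h : ∀ ε : ℝ, 0 < ε → ∃ G, MeasurableSet[m] G ∧ μ.real (A ∆ G) < ε) :
    EventuallyMeasurableSet m (ae μ) A := by
  choose G hG hA using fun t : ℕ => h ((1 / 2) ^ t) (by positivity)
  refine ⟨limsup G atTop, @MeasurableSet.measurableSet_limsup X m G hG, eventuallyEq_set.2 ?_⟩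
  filter_upwards [ae_eventually_notMem_of_measureReal_le_geometric fun t => (hA t).le] with x hx
  have hGA : ∀ᶠ t in atTop, (x ∈ G t ↔ x ∈ A) := by
    filter_upwards [hx] with t ht
    rw [Set.mem_symmDiff] at ht
    tauto
  rw [mem_limsup_iff_frequently_mem, frequently_congr hGA, frequently_const]

theorem exists_measurable_eventuallyEq {X Z : Type*} [MeasurableSpace Z] [StandardBorelSpace Z]
    [Nonempty Z] {m : MeasurableSpace X} {l : Filter X} [CountableInterFilter l] {f : X → Z}
    (hf : EventuallyMeasurable m l f) : ∃ g : X → Z, Measurable[m] g ∧ f =ᶠ[l] g := by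
  classical
  -- A point of `Z` is encoded by countably many bits, each of which can be corrected separately.
  have hcode := MeasurableSpace.measurable_mapNatBool Z
  obtain ⟨decode, hdecode, hdecode_code⟩ :=
    (hcode.measurableEmbedding (MeasurableSpace.injective_mapNatBool Z)).exists_measurable_extend
      measurable_id fun _ => ‹Nonempty Z›
  have hdigit (n : ℕ) : EventuallyMeasurableSet m l {x | MeasurableSpace.mapNatBool Z (f x) n} :=
    hf (((measurable_pi_apply n).comp hcode) (MeasurableSet.singleton true))
  choose G hG hfG using hdigit
  refine ⟨fun x => decode fun n => decide (x ∈ G n), hdecode.comp (measurable_pi_iff.2 fun n =>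
    measurable_to_bool (by simpa [Set.preimage] using hG n)), ?_⟩
  filter_upwards [eventually_countable_forall.2 fun n => (hfG n).mem_iff] with x hx
  have : (fun n => decide (x ∈ G n)) = MeasurableSpace.mapNatBool Z (f x) := by
    funext n
    rw [Bool.eq_iff_iff, decide_eq_true_iff, ← hx n]
  rw [this]
  exact (congrFun hdecode_code (f x)).symm

theorem exists_ae_inverse_of_eventuallyMeasurableSet {X Y : Type*} [MeasurableSpace X]
    [StandardBorelSpace X] [Nonempty X] [mY : MeasurableSpace Y] [MeasurableEq Y]
    {μ : Measure X} {ν : Measure Y} {φ : X → Y} (hφ : MeasurePreserving φ μ ν)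
    (h : ∀ A, MeasurableSet A → EventuallyMeasurableSet (mY.comap φ) (ae μ) A) :
    ∃ ψ : Y → X, MeasurePreserving ψ ν μ ∧ (∀ᵐ x ∂μ, ψ (φ x) = x) ∧ ∀ᵐ y ∂ν, φ (ψ y) = y := by
  obtain ⟨g, hg, hgid⟩ := exists_measurable_eventuallyEq (f := (id : X → X)) h
  obtain ⟨ψ, hψ, rfl⟩ := hg.exists_eq_measurable_comp
  have hψφ : ∀ᵐ x ∂μ, ψ (φ x) = x := hgid.symm
  refine ⟨ψ, ⟨hψ, ?_⟩, hψφ, ?_⟩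
  · rw [← hφ.map_eq, Measure.map_map hψ hφ.measurable, Measure.map_congr hgid.symm, Measure.map_id]
  · rw [← hφ.map_eq]
    refine (ae_map_iff hφ.measurable.aemeasurable
      (measurableSet_eq_fun (hφ.measurable.comp hψ) measurable_id)).2 ?_
    exact hψφ.mono fun x hx => congrArg φ hx

theorem symmDiff_filter_range_subset_succ {n : ℕ} {I : Finset ℕ} (hI : I ⊆ Finset.range n)
    (p : ℕ → Prop) [DecidablePred p] :
    (Finset.range n).filter p ∆ I ⊆ (Finset.range (n + 1)).filter p ∆ I := by
  intro i hi
  have := @hI i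
  simp only [Finset.mem_symmDiff, Finset.mem_filter, Finset.mem_range] at this hi ⊢
  grind

theorem card_symmDiff_filter_range_succ_le (n : ℕ) (I : Finset ℕ) (p : ℕ → Prop)
    [DecidablePred p] :
    ((Finset.range (n + 1)).filter p ∆ I).card ≤ ((Finset.range n).filter p ∆ I).card + 1 := by
  refine (Finset.card_le_card fun i hi => ?_).trans (Finset.card_insert_le n _)
  simp only [Finset.mem_insert, Finset.mem_symmDiff, Finset.mem_filter, Finset.mem_range] at hi ⊢
  grind

namespace MPTransformation

variable {X : Type*} [MeasurableSpace X] {μ : Measure X} (T : MPTransformation μ)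

theorem image_add (a b : ℕ) (A : Set X) : T.image (a + b) A = T.image a (T.image b A) := by
  simp only [image, ← Set.preimage_comp, ← Function.iterate_add, add_comm a b]

theorem image_ae_congr (k : ℕ) {A A' : Set X} (h : A =ᵐ[μ] A') :
    T.image k A =ᵐ[μ] T.image k A' :=
  (T.measurePreserving_inv.iterate k).quasiMeasurePreserving.preimage_ae_eq h

theorem measurableSet_image (k : ℕ) {A : Set X} (h : MeasurableSet A) :
    MeasurableSet (T.image k A) :=
  (T.measurePreserving_inv.iterate k).measurable h

theorem measureReal_image (k : ℕ) {A : Set X} (h : MeasurableSet A) :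
    μ.real (T.image k A) = μ.real A :=
  (T.measurePreserving_inv.iterate k).measureReal_preimage h.nullMeasurableSet

theorem IsFactorMap.eventuallyMeasurableSet_image {Y : Type*} [mY : MeasurableSpace Y]
    {ν : Measure Y} {S : MPTransformation ν} {φ : X → Y} (hφ : T.IsFactorMap S φ) {A : Set X}
    (hA : EventuallyMeasurableSet (mY.comap φ) (ae μ) A) (k : ℕ) :
    EventuallyMeasurableSet (mY.comap φ) (ae μ) (T.image k A) := by
  induction k with
  | zero => exact hA
  | succ k ih =>
    obtain ⟨_, ⟨G, hG, rfl⟩, hAG⟩ := ih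
    rw [add_comm, image_add]
    refine ⟨φ ⁻¹' (S.invFun ⁻¹' G), ⟨_, S.measurePreserving_inv.measurable hG, rfl⟩,
      (T.image_ae_congr 1 hAG).trans ?_⟩
    refine eventuallyEq_set.2 ?_
    have hinv := T.measurePreserving_inv.quasiMeasurePreserving
    filter_upwards [hinv.ae hφ.2, T.right_inv,
      hinv.ae (hφ.1.quasiMeasurePreserving.ae S.left_inv)] with x hequi hright hleft
    rw [hright] at hequi
    rw [← hequi] at hleft
    change φ (T.invFun x) ∈ G ↔ S.invFun (φ x) ∈ G
    rw [hleft]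

/-- A factor map from `T` onto the rotation by `1` of `ℤ/kℤ`, without reference to the measure on
`ℤ/kℤ`. -/
structure IsCyclicFactorMap {k : ℕ} (f : X → ZMod k) : Prop where
  measurable : Measurable f
  map_toFun : ∀ᵐ x ∂μ, f (T.toFun x) = f x + 1

namespace IsCyclicFactorMap

variable {T} {k : ℕ} {f : X → ZMod k}

theorem castHom (hf : T.IsCyclicFactorMap f) {k' : ℕ} (hk' : k' ∣ k) :
    T.IsCyclicFactorMap fun x => ZMod.castHom hk' (ZMod k') (f x) where
  measurable := Measurable.of_discrete.comp hf.measurable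
  map_toFun := hf.map_toFun.mono fun x hx => by rw [hx, map_add, map_one]

theorem comp {Y : Type*} [MeasurableSpace Y] {ν : Measure Y} {S : MPTransformation ν}
    {g : Y → ZMod k} (hg : S.IsCyclicFactorMap g) {φ : X → Y} (hφ : T.IsFactorMap S φ) :
    T.IsCyclicFactorMap (g ∘ φ) where
  measurable := hg.measurable.comp hφ.1.measurable
  map_toFun := by
    filter_upwards [hφ.2, hφ.1.quasiMeasurePreserving.ae hg.map_toFun] with x hφx hgx
    simp only [Function.comp_apply, hφx, hgx]

theorem measurableSet_setOf (hf : T.IsCyclicFactorMap f) (p : ZMod k → Prop) :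
    MeasurableSet {x | p (f x)} :=
  hf.measurable (MeasurableSet.of_discrete (s := {z | p z}))

theorem ae_eq_add (hf : T.IsCyclicFactorMap f) :
    ∀ᵐ x ∂μ, ∀ i : ℕ, f x = f (T.invFun^[i] x) + i := by
  have hinv : ∀ᵐ x ∂μ, f x = f (T.invFun x) + 1 := by
    filter_upwards [T.measurePreserving_inv.quasiMeasurePreserving.ae hf.map_toFun, T.right_inv]
      with x hx hright
    rwa [hright] at hx
  filter_upwards [ae_all_iff.2 fun i =>
    (T.measurePreserving_inv.iterate i).quasiMeasurePreserving.ae hinv] with x hx i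
  induction i with
  | zero => simp
  | succ i ih =>
    rw [ih, hx i, Function.iterate_succ_apply', Nat.cast_succ]
    ring

theorem measure_preimage_singleton [NeZero k] [IsProbabilityMeasure μ]
    (hf : T.IsCyclicFactorMap f) (i : ZMod k) : μ (f ⁻¹' {i}) = (k : ℝ≥0∞)⁻¹ := by
  have hmeas (j : ZMod k) : MeasurableSet (f ⁻¹' {j}) := hf.measurableSet_setOf (· = j)
  have hsucc (j : ZMod k) : μ (f ⁻¹' {j + 1}) = μ (f ⁻¹' {j}) := by
    rw [← T.measurePreserving.measure_preimage (hmeas (j + 1)).nullMeasurableSet]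
    refine measure_congr (eventuallyEq_set.2 (hf.map_toFun.mono fun x hx => ?_))
    simp only [Set.mem_preimage, Set.mem_singleton_iff, hx, add_left_inj]
  have hnat (a : ℕ) : μ (f ⁻¹' {(a : ZMod k)}) = μ (f ⁻¹' {0}) := by
    induction a with
    | zero => rw [Nat.cast_zero]
    | succ a ih => rw [Nat.cast_succ, hsucc, ih]
  have hconst (j : ZMod k) : μ (f ⁻¹' {j}) = μ (f ⁻¹' {0}) := by
    rw [← hnat j.val, ZMod.natCast_zmod_val]
  have hsum : ∑ j : ZMod k, μ (f ⁻¹' {j}) = 1 := by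
    rw [sum_measure_preimage_singleton _ fun j _ => hmeas j, Finset.coe_univ, Set.preimage_univ,
      measure_univ]
  simp only [hconst, Finset.sum_const, Finset.card_univ, ZMod.card, nsmul_eq_mul] at hsum
  rw [hconst i]
  exact ENNReal.eq_inv_of_mul_eq_one_left (by rwa [mul_comm])

end IsCyclicFactorMap

end MPTransformation

namespace RankOnePresentation

open scoped Pointwise

variable {X : Type*} [MeasurableSpace X] {μ : Measure X} {T : MPTransformation μ}
  (P : RankOnePresentation T)

/-- A measurable version of the base of the stage-`n` tower. -/
def base (n : ℕ) : Set X := toMeasurable μ (P.B n)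

/-- A measurable version of the `i`-th level of the stage-`n` tower. -/
def level (n i : ℕ) : Set X := T.image i (P.base n)

/-- The union of the levels of the stage-`n` tower with indices in `J`. -/
def levels (n : ℕ) (J : Finset ℕ) : Set X := ⋃ i ∈ J, P.level n i

/-- The union of all levels of the stage-`n` tower. -/
def tower (n : ℕ) : Set X := P.levels n (Finset.range (P.h n))

/-- The position in the stage-`n + 1` tower of the `i + 1`-st copy of the stage-`n` tower. -/
def offset (n i : ℕ) : ℕ := i * P.h n + ∑ j ∈ Finset.Icc 1 i, P.s n j

theorem offset_succ (n i : ℕ) : P.offset n (i + 1) = P.offset n i + P.h n + P.s n (i + 1) := by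
  simp only [offset, Finset.sum_Icc_succ_top (Nat.le_add_left 1 i)]
  ring

theorem monotone_offset (n : ℕ) : Monotone (P.offset n) :=
  monotone_nat_of_le_succ fun i => by rw [offset_succ]; omega

theorem h_succ (n : ℕ) : P.h (n + 1) = P.offset n (P.r n) := rfl

theorem offset_add_h_le {n i : ℕ} (hi : i < P.r n) : P.offset n i + P.h n ≤ P.h (n + 1) := by
  have := P.monotone_offset n hi
  rw [Nat.succ_eq_add_one, offset_succ] at this
  rw [h_succ]
  omega

theorem lt_h (n : ℕ) : n < P.h n := by
  induction n with
  | zero => exact one_pos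
  | succ n ih =>
    have hcopy := P.offset_add_h_le (P.one_lt_r n)
    rw [offset_succ] at hcopy
    omega

theorem base_ae_eq (n : ℕ) : P.base n =ᵐ[μ] P.B n := (P.measurable_B n).toMeasurable_ae_eq

theorem level_ae_eq (n i : ℕ) : P.level n i =ᵐ[μ] T.image i (P.B n) :=
  T.image_ae_congr i (P.base_ae_eq n)

theorem level_zero (n : ℕ) : P.level n 0 = P.base n := rfl

theorem level_add (n a b : ℕ) : P.level n (a + b) = T.image a (P.level n b) :=
  T.image_add a b _

theorem mem_levels {n : ℕ} {J : Finset ℕ} {x : X} :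
    x ∈ P.levels n J ↔ ∃ i ∈ J, x ∈ P.level n i := by
  simp [levels]

theorem levels_mono {n : ℕ} {J J' : Finset ℕ} (h : J ⊆ J') : P.levels n J ⊆ P.levels n J' :=
  Set.biUnion_subset_biUnion_left h

theorem levels_singleton_zero (n : ℕ) : P.levels n {0} = P.base n := by simp [levels, level_zero]

theorem measurableSet_base (n : ℕ) : MeasurableSet (P.base n) := measurableSet_toMeasurable _ _

theorem measurableSet_level (n i : ℕ) : MeasurableSet (P.level n i) :=
  T.measurableSet_image i (P.measurableSet_base n)

theorem measurableSet_levels (n : ℕ) (J : Finset ℕ) : MeasurableSet (P.levels n J) :=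
  Finset.measurableSet_biUnion _ fun i _ => P.measurableSet_level n i

theorem measureReal_level (n i : ℕ) : μ.real (P.level n i) = μ.real (P.base n) :=
  T.measureReal_image i (P.measurableSet_base n)

theorem aedisjoint_level {n a b : ℕ} (ha : a < P.h n) (hb : b < P.h n) (hab : a ≠ b) :
    AEDisjoint μ (P.level n a) (P.level n b) :=
  (P.disjoint_levels n a ha b hb hab).congr (P.level_ae_eq n a) (P.level_ae_eq n b)

theorem levels_add (n : ℕ) (J O : Finset ℕ) :
    P.levels n (J + O) = ⋃ i ∈ J, T.image i (P.levels n O) := by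
  ext x
  simp only [mem_levels, Finset.mem_add, Set.mem_iUnion₂, exists_prop]
  constructor
  · rintro ⟨_, ⟨i, hi, c, hc, rfl⟩, hx⟩
    exact ⟨i, hi, P.mem_levels.2 ⟨c, hc, by rwa [level_add] at hx⟩⟩
  · rintro ⟨i, hi, hx⟩
    obtain ⟨c, hc, hxc⟩ := P.mem_levels.1 hx
    exact ⟨i + c, ⟨i, hi, c, hc, rfl⟩, by rwa [level_add]⟩

theorem levels_ae_eq_levels_add {m n : ℕ} {O : Finset ℕ} (h : P.base m =ᵐ[μ] P.levels n O)
    (J : Finset ℕ) : P.levels m J =ᵐ[μ] P.levels n (J + O) := by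
  rw [levels_add]
  exact EventuallyEq.biUnion J.finite_toSet fun i _ => T.image_ae_congr i h

theorem image_Bsub_ae_eq_C {n i j : ℕ} (hi : i ∈ Finset.Icc 1 (P.r n)) (hj : j < P.s n i) :
    T.image (P.h n + j) (P.Bsub n i) =ᵐ[μ] P.C n i (j + 1) := by
  induction j with
  | zero => exact P.image_Bsub_of_ne_zero n i hi hj.ne'
  | succ j ih =>
    rw [show P.h n + (j + 1) = 1 + (P.h n + j) by ring, T.image_add]
    exact (T.image_ae_congr 1 (ih (by omega))).trans
      (P.image_C n i hi (j + 1) (by simp; omega) hj)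

theorem image_Bsub_ae_eq_Bsub_succ {n i : ℕ} (hi : 0 < i) (hir : i < P.r n) :
    T.image (P.h n + P.s n i) (P.Bsub n i) =ᵐ[μ] P.Bsub n (i + 1) := by
  have hmem : i ∈ Finset.Icc 1 (P.r n) := Finset.mem_Icc.2 ⟨hi, hir.le⟩
  by_cases hs : P.s n i = 0
  · rw [hs]
    exact P.image_Bsub_of_eq_zero n i hmem hir hs
  · have hlast := P.image_C_last n i hmem hir hs
    obtain ⟨j, hj⟩ := Nat.exists_eq_add_one_of_ne_zero hs
    rw [hj] at hlast ⊢
    rw [show P.h n + (j + 1) = 1 + (P.h n + j) by ring, T.image_add]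
    exact (T.image_ae_congr 1 (P.image_Bsub_ae_eq_C hmem (by omega))).trans hlast

theorem Bsub_succ_ae_eq {n i : ℕ} (hi : i < P.r n) :
    P.Bsub n (i + 1) =ᵐ[μ] P.level (n + 1) (P.offset n i) := by
  induction i with
  | zero =>
    rw [show P.offset n 0 = 0 by simp [offset]]
    exact (P.B_succ n).symm.trans (P.base_ae_eq (n + 1)).symm
  | succ i ih =>
    rw [offset_succ, show P.offset n i + P.h n + P.s n (i + 1) =
      P.h n + P.s n (i + 1) + P.offset n i by ring, level_add]
    exact (P.image_Bsub_ae_eq_Bsub_succ i.succ_pos hi).symm.trans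
      (T.image_ae_congr _ (ih (Nat.lt_of_succ_lt hi)))

theorem base_ae_eq_levels_succ (n : ℕ) :
    P.base n =ᵐ[μ] P.levels (n + 1) ((Finset.range (P.r n)).image (P.offset n)) := by
  have hIcc : Finset.Icc 1 (P.r n) = (Finset.range (P.r n)).image (· + 1) := by
    ext i
    simp only [Finset.mem_Icc, Finset.mem_image, Finset.mem_range]
    exact ⟨fun h => ⟨i - 1, by omega⟩, by rintro ⟨j, hj, rfl⟩; omega⟩
  have hsub : (⋃ i ∈ Finset.Icc 1 (P.r n), P.Bsub n i) =
      ⋃ i ∈ Finset.range (P.r n), P.Bsub n (i + 1) := by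
    rw [hIcc, Finset.set_biUnion_finset_image]
  rw [levels, Finset.set_biUnion_finset_image]
  refine (P.base_ae_eq n).trans ((P.iUnion_Bsub n).symm.trans ?_)
  rw [hsub]
  exact EventuallyEq.biUnion (Finset.finite_toSet _) fun i hi =>
    P.Bsub_succ_ae_eq (Finset.mem_range.1 hi)

theorem exists_base_ae_eq_levels {m n : ℕ} (hmn : m ≤ n) :
    ∃ O : Finset ℕ, O.Nonempty ∧ (∀ c ∈ O, c + P.h m ≤ P.h n) ∧ P.base m =ᵐ[μ] P.levels n O := by
  induction n, hmn using Nat.le_induction with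
  | base => exact ⟨{0}, by simp, by simp, (P.levels_singleton_zero m).symm.eventuallyEq⟩
  | succ n _ ih =>
    obtain ⟨O, hne, hO, hbase⟩ := ih
    have hr : 0 < P.r n := (P.one_lt_r n).le
    refine ⟨O + (Finset.range (P.r n)).image (P.offset n),
      hne.add (by simpa using hr.ne'), fun c hc => ?_,
      hbase.trans (P.levels_ae_eq_levels_add (P.base_ae_eq_levels_succ n) O)⟩
    simp only [Finset.mem_add, Finset.mem_image, Finset.mem_range] at hc
    obtain ⟨a, ha, _, ⟨i, hi, rfl⟩, rfl⟩ := hc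
    have := P.offset_add_h_le hi
    have := hO a ha
    omega

theorem ae_le_tower_of_le {m n : ℕ} (hmn : m ≤ n) : P.tower m ≤ᵐ[μ] P.tower n := by
  obtain ⟨O, -, hO, hbase⟩ := P.exists_base_ae_eq_levels hmn
  refine (P.levels_ae_eq_levels_add hbase _).le.trans (P.levels_mono fun c hc => ?_).eventuallyLE
  obtain ⟨i, hi, o, ho, rfl⟩ := Finset.mem_add.1 hc
  have := hO o ho
  rw [Finset.mem_range] at hi ⊢
  omega

theorem I_subset (m n : ℕ) : P.I m n ⊆ Finset.range (P.h n) := by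
  classical exact Finset.filter_subset _ _

theorem ae_eq_of_mem_level (n : ℕ) :
    ∀ᵐ x ∂μ, ∀ a < P.h n, ∀ b < P.h n, x ∈ P.level n a → x ∈ P.level n b → a = b := by
  simp only [ae_all_iff, eventually_imp_distrib_left]
  intro a ha b hb
  by_cases hab : a = b
  · exact .of_forall fun _ _ _ => hab
  · filter_upwards [measure_eq_zero_iff_ae_notMem.1 (P.aedisjoint_level ha hb hab)]
      with x hx hxa hxb
    exact (hx ⟨hxa, hxb⟩).elim

/-- The index of the level of the stage-`n` tower that contains `x`. It is `0` off the tower, and it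
is a meaningless sum on the null set where two levels meet. -/
noncomputable def index (n : ℕ) (x : X) : ℕ :=
  ∑ i ∈ Finset.range (P.h n), (P.level n i).indicator (fun _ => i) x

theorem measurable_index (n : ℕ) : Measurable (P.index n) :=
  Finset.measurable_sum _ fun i _ => measurable_const.indicator (P.measurableSet_level n i)

theorem ae_index_eq (n : ℕ) : ∀ᵐ x ∂μ, ∀ i < P.h n, x ∈ P.level n i → P.index n x = i := by
  filter_upwards [P.ae_eq_of_mem_level n] with x hx i hi hxi
  rw [index, Finset.sum_eq_single_of_mem i (Finset.mem_range.2 hi), Set.indicator_of_mem hxi]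
  exact fun b hb hbi => Set.indicator_of_notMem
    (fun hxb => hbi (hx b (Finset.mem_range.1 hb) i hi hxb hxi)) _

theorem ae_mem_levels_iff (n : ℕ) :
    ∀ᵐ x ∂μ, ∀ S ⊆ Finset.range (P.h n), (x ∈ P.levels n S ↔ x ∈ P.tower n ∧ P.index n x ∈ S) := by
  filter_upwards [P.ae_index_eq n] with x hx S hS
  refine ⟨fun hxS => ⟨P.levels_mono hS hxS, ?_⟩, fun ⟨hxt, hxS⟩ => ?_⟩
  · obtain ⟨i, hi, hxi⟩ := P.mem_levels.1 hxS
    rwa [hx i (Finset.mem_range.1 (hS hi)) hxi]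
  · obtain ⟨i, hi, hxi⟩ := P.mem_levels.1 hxt
    rw [hx i (Finset.mem_range.1 hi) hxi] at hxS
    exact P.mem_levels.2 ⟨i, hxS, hxi⟩

theorem measureReal_level_inter_ne {k : ℕ} {f : X → ZMod k} (hf : T.IsCyclicFactorMap f) (n i : ℕ)
    (z : ZMod k) :
    μ.real (P.level n i ∩ {x | f x ≠ z}) = μ.real (P.base n ∩ {x | f x ≠ z - i}) := by
  rw [← T.measureReal_image i ((P.measurableSet_base n).inter (hf.measurableSet_setOf (· ≠ z - i)))]
  refine measureReal_congr (eventuallyEq_set.2 ?_)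
  filter_upwards [hf.ae_eq_add] with x hx
  have hiff : f x ≠ z ↔ f (T.invFun^[i] x) ≠ z - i := by rw [hx i, Ne, ← eq_sub_iff_add_eq]
  exact and_congr_right fun _ => hiff

/-- Condition (IIa) for the modulus `k`: the indices of the copies of the stage-`m` tower in the
stage-`n` tower lie, up to a small proportion, in a single residue class. -/
def ResiduesConcentrated (k : ℕ) : Prop :=
  ∀ η : ℝ, 0 < η → ∃ N : ℕ, ∀ m n : ℕ, N ≤ m → m ≤ n → ∃ j : ZMod k,
    (((P.I m n).filter (fun i : ℕ => (i : ZMod k) ≠ j)).card : ℝ) / (P.I m n).card < η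

/-- The inner part of condition (IIb): in all sufficiently late towers, the set of levels contained
in the base of the stage-`l` tower is a union of residue classes modulo `k` up to an error `ε`. As
in the paper, the indices range over `0 ≤ i ≤ h m`, one more than there are levels. -/
def BaseNearResidues (k l : ℕ) (ε : ℝ) : Prop :=
  ∃ N : ℕ, l ≤ N ∧ ∀ m : ℕ, N ≤ m → ∃ D : Finset (ZMod k),
    ((((Finset.range (P.h m + 1)).filter (fun i : ℕ => (i : ZMod k) ∈ D)) ∆ P.I l m).card : ℝ) /
      (P.I l m).card < ε

variable [IsProbabilityMeasure μ]

theorem measureReal_levels {n : ℕ} {J : Finset ℕ} (hJ : J ⊆ Finset.range (P.h n)) :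
    μ.real (P.levels n J) = J.card * μ.real (P.base n) := by
  rw [levels, measureReal_biUnion_finset₀
    (fun a ha b hb hab =>
      P.aedisjoint_level (Finset.mem_range.1 (hJ ha)) (Finset.mem_range.1 (hJ hb)) hab)
    (fun i _ => (P.measurableSet_level n i).nullMeasurableSet)]
  simp [measureReal_level]

theorem measureReal_tower (n : ℕ) : μ.real (P.tower n) = P.h n * μ.real (P.base n) := by
  rw [tower, P.measureReal_levels subset_rfl, Finset.card_range]

theorem exists_levels_approx {A : Set X} (hA : MeasurableSet A) {ε : ℝ} (hε : 0 < ε) :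
    ∃ n, ∃ J ⊆ Finset.range (P.h n), μ.real (A ∆ P.levels n J) < ε := by
  obtain ⟨n, J, hJ, hAJ⟩ := P.dense_levels A hA (ENNReal.ofReal ε) (by simpa using hε)
  have hlevels : P.levels n J =ᵐ[μ] ⋃ i ∈ J, T.image i (P.B n) :=
    EventuallyEq.biUnion J.finite_toSet fun i _ => P.level_ae_eq n i
  refine ⟨n, J, hJ, ?_⟩
  rw [measureReal_congr ((ae_eq_refl A).symmDiff hlevels)]
  exact (ENNReal.lt_ofReal_iff_toReal_lt (measure_ne_top _ _)).1 hAJ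

theorem tendsto_measureReal_tower : Tendsto (fun n => μ.real (P.tower n)) atTop (𝓝 1) := by
  refine tendsto_order.2 ⟨fun a ha => ?_, fun a ha => .of_forall fun n =>
    measureReal_le_one.trans_lt ha⟩
  obtain ⟨n, J, hJ, hn⟩ := P.exists_levels_approx MeasurableSet.univ (sub_pos.2 ha)
  have hcompl : (Set.univ ∆ P.levels n J : Set X) = (P.levels n J)ᶜ := by
    ext; simp [Set.mem_symmDiff]
  rw [hcompl, probReal_compl_eq_one_sub (P.measurableSet_levels n J)] at hn
  filter_upwards [eventually_ge_atTop n] with m hm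
  have hsub : μ.real (P.levels n J) ≤ μ.real (P.tower n) := measureReal_mono (P.levels_mono hJ)
  have hmono := measureReal_mono_ae (P.ae_le_tower_of_le hm)
  linarith

theorem measureReal_base_pos (n : ℕ) : 0 < μ.real (P.base n) := by
  obtain ⟨m, hm, hnm⟩ := ((P.tendsto_measureReal_tower.eventually (lt_mem_nhds one_pos)).and
    (eventually_ge_atTop n)).exists
  obtain ⟨O, ⟨c, hc⟩, -, hbase⟩ := P.exists_base_ae_eq_levels hnm
  rw [measureReal_tower] at hm
  calc 0 < μ.real (P.base m) := pos_of_mul_pos_right hm (Nat.cast_nonneg _)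
    _ = μ.real (P.level m c) := (P.measureReal_level m c).symm
    _ ≤ μ.real (P.levels m O) := measureReal_mono fun x hx => P.mem_levels.2 ⟨c, hc, hx⟩
    _ = μ.real (P.base n) := (measureReal_congr hbase).symm

theorem tendsto_measureReal_base : Tendsto (fun n => μ.real (P.base n)) atTop (𝓝 0) := by
  refine squeeze_zero (fun n => measureReal_nonneg) (fun n => ?_)
    tendsto_one_div_add_atTop_nhds_zero_nat
  have htower : (P.h n : ℝ) * μ.real (P.base n) ≤ 1 :=
    (P.measureReal_tower n).symm.trans_le measureReal_le_one
  have hh : (n : ℝ) + 1 ≤ P.h n := by exact_mod_cast P.lt_h n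
  rw [le_div_iff₀ (by positivity), mul_comm]
  exact (mul_le_mul_of_nonneg_right hh measureReal_nonneg).trans htower

theorem level_ae_le_levels_iff {n i : ℕ} (hi : i < P.h n) {J : Finset ℕ}
    (hJ : J ⊆ Finset.range (P.h n)) : P.level n i ≤ᵐ[μ] P.levels n J ↔ i ∈ J := by
  refine ⟨fun hle => ?_, fun hiJ => .of_forall fun x hx => P.mem_levels.2 ⟨i, hiJ, hx⟩⟩
  have hpos : ¬ μ (P.level n i) = 0 := fun hzero =>
    (P.measureReal_base_pos n).ne' (by rw [← P.measureReal_level n i, measureReal_def, hzero]; rfl)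
  obtain ⟨x, hx, hxle, hxuniq⟩ := ((frequently_ae_mem_iff.2 hpos).and_eventually
    (hle.and (P.ae_eq_of_mem_level n))).exists
  obtain ⟨c, hc, hxc⟩ := P.mem_levels.1 (hxle hx)
  exact hxuniq i hi c (Finset.mem_range.1 (hJ hc)) hx hxc ▸ hc

theorem I_eq {m n : ℕ} {O : Finset ℕ} (hO : O ⊆ Finset.range (P.h n))
    (hbase : P.base m =ᵐ[μ] P.levels n O) : P.I m n = O := by
  ext i
  simp only [I, Finset.mem_filter, Finset.mem_range]
  have hiff (hi : i < P.h n) : T.image i (P.B n) ≤ᵐ[μ] P.B m ↔ i ∈ O := by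
    rw [← P.level_ae_le_levels_iff hi hO]
    have hB := (P.base_ae_eq m).symm.trans hbase
    exact ⟨fun h => ((P.level_ae_eq n i).le.trans h).trans hB.le,
      fun h => ((P.level_ae_eq n i).symm.le.trans h).trans hB.symm.le⟩
  exact ⟨fun ⟨hi, hle⟩ => (hiff hi).1 hle,
    fun hi => ⟨Finset.mem_range.1 (hO hi), (hiff (Finset.mem_range.1 (hO hi))).2 hi⟩⟩

theorem I_spec {m n : ℕ} (hmn : m ≤ n) :
    (∀ c ∈ P.I m n, c + P.h m ≤ P.h n) ∧ P.base m =ᵐ[μ] P.levels n (P.I m n) := by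
  obtain ⟨O, -, hO, hbase⟩ := P.exists_base_ae_eq_levels hmn
  have hOsub : O ⊆ Finset.range (P.h n) := fun c hc =>
    Finset.mem_range.2 (by have := hO c hc; have := P.lt_h m; omega)
  rw [P.I_eq hOsub hbase]
  exact ⟨hO, hbase⟩

theorem add_h_le_of_mem_I {m n c : ℕ} (hmn : m ≤ n) (hc : c ∈ P.I m n) : c + P.h m ≤ P.h n :=
  (P.I_spec hmn).1 c hc

theorem base_ae_eq_levels_I {m n : ℕ} (hmn : m ≤ n) : P.base m =ᵐ[μ] P.levels n (P.I m n) :=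
  (P.I_spec hmn).2

theorem measureReal_base_eq_card_I_mul {m n : ℕ} (hmn : m ≤ n) :
    μ.real (P.base m) = (P.I m n).card * μ.real (P.base n) := by
  rw [measureReal_congr (P.base_ae_eq_levels_I hmn), P.measureReal_levels (P.I_subset m n)]

theorem card_div_mul_measureReal_base {m n : ℕ} (hmn : m ≤ n) (c : ℝ) :
    c / (P.I m n).card * μ.real (P.base m) = c * μ.real (P.base n) := by
  have hbase := P.measureReal_base_eq_card_I_mul hmn
  have hI : ((P.I m n).card : ℝ) ≠ 0 :=
    left_ne_zero_of_mul (hbase ▸ (P.measureReal_base_pos m).ne')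
  rw [hbase]
  field_simp

theorem eventually_levels_approx {A : Set X} (hA : MeasurableSet A) {ε : ℝ} (hε : 0 < ε) :
    ∀ᶠ n in atTop, ∃ J ⊆ Finset.range (P.h n), μ.real (A ∆ P.levels n J) < ε := by
  obtain ⟨m, J, hJ, hAJ⟩ := P.exists_levels_approx hA hε
  filter_upwards [eventually_ge_atTop m] with n hmn
  refine ⟨J + P.I m n, fun i hi => ?_, ?_⟩
  · obtain ⟨a, ha, c, hc, rfl⟩ := Finset.mem_add.1 hi
    have := P.add_h_le_of_mem_I hmn hc
    have := Finset.mem_range.1 (hJ ha)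
    exact Finset.mem_range.2 (by omega)
  · rwa [measureReal_congr ((ae_eq_refl A).symmDiff
      (P.levels_ae_eq_levels_add (P.base_ae_eq_levels_I hmn) J))] at hAJ

theorem tendsto_measureReal_compl_tower :
    Tendsto (fun n => μ.real (P.tower n)ᶜ) atTop (𝓝 0) := by
  simpa only [probReal_compl_eq_one_sub (P.measurableSet_levels _ _), tower, sub_self] using
    P.tendsto_measureReal_tower.const_sub 1

theorem eventually_exists_measureReal_ne_index_lt {α : Type*} [Finite α] [Nonempty α]
    [MeasurableSpace α] [MeasurableSingletonClass α] {f : X → α} (hf : Measurable f) {ε : ℝ}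
    (hε : 0 < ε) : ∀ᶠ n in atTop, ∃ a : ℕ → α, μ.real {x | f x ≠ a (P.index n x)} < ε := by
  have := Fintype.ofFinite α
  have happrox : ∀ᶠ n in atTop, ∀ z : α, ∃ J ⊆ Finset.range (P.h n),
      μ.real ((f ⁻¹' {z}) ∆ P.levels n J) < ε / Fintype.card α :=
    eventually_all.2 fun z => P.eventually_levels_approx (hf (measurableSet_singleton z))
      (by have := Fintype.card_pos (α := α); positivity)
  filter_upwards [happrox] with n hn
  choose J hJ hfJ using hn
  let a (i : ℕ) : α := Classical.epsilon fun z => i ∈ J z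
  have ha {i : ℕ} {z : α} (hi : i ∈ J z) : i ∈ J (a i) :=
    Classical.epsilon_spec (p := fun z => i ∈ J z) ⟨z, hi⟩
  refine ⟨a, ?_⟩
  calc μ.real {x | f x ≠ a (P.index n x)}
      ≤ μ.real (⋃ z ∈ (Finset.univ : Finset α), (f ⁻¹' {z}) ∆ P.levels n (J z)) := by
        refine measureReal_mono_ae ?_
        filter_upwards [P.ae_mem_levels_iff n] with x hx hne
        by_contra hgood
        have hmem (z : α) : f x = z ↔ x ∈ P.levels n (J z) := by
          have := fun hz => hgood (Set.mem_iUnion₂.2 ⟨z, Finset.mem_univ z, hz⟩)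
          rw [Set.mem_symmDiff] at this
          change x ∈ f ⁻¹' {z} ↔ _
          tauto
        obtain ⟨hxt, hxJ⟩ := (hx _ (hJ _)).1 ((hmem (f x)).1 rfl)
        exact hne ((hmem _).2 ((hx _ (hJ _)).2 ⟨hxt, ha hxJ⟩))
    _ ≤ ∑ z : α, μ.real ((f ⁻¹' {z}) ∆ P.levels n (J z)) := measureReal_biUnion_finset_le _ _
    _ < ∑ _ : α, ε / Fintype.card α :=
        Finset.sum_lt_sum_of_nonempty Finset.univ_nonempty fun _ _ => hfJ _
    _ = ε := by
        rw [Finset.sum_const, Finset.card_univ, nsmul_eq_mul]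
        field_simp

theorem measureReal_tower_inter_symmDiff_base {l m : ℕ} (hlm : l ≤ m) (p : ℕ → Prop)
    [DecidablePred p] :
    μ.real (P.tower m ∩ ({x | p (P.index m x)} ∆ P.base l)) =
      ((Finset.range (P.h m)).filter p ∆ P.I l m).card * μ.real (P.base m) := by
  have hI := P.I_subset l m
  have hsub : (Finset.range (P.h m)).filter p ∆ P.I l m ⊆ Finset.range (P.h m) :=
    symmDiff_le_sup.trans (sup_le (Finset.filter_subset _ _) hI)
  rw [← P.measureReal_levels hsub]
  refine measureReal_congr (eventuallyEq_set.2 ?_)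
  filter_upwards [P.ae_mem_levels_iff m, (P.base_ae_eq_levels_I hlm).mem_iff] with x hx hbase
  have htower : x ∈ P.tower m ↔ _ := hx _ subset_rfl
  rw [hx _ hsub, Set.mem_inter_iff, Set.mem_symmDiff, Set.mem_ofPred_eq, hbase, hx _ hI,
    Finset.mem_symmDiff, Finset.mem_filter]
  tauto

theorem measureReal_tower_inter_symmDiff_base_le {l m : ℕ} (hlm : l ≤ m) (p : ℕ → Prop)
    [DecidablePred p] :
    μ.real (P.tower m ∩ ({x | p (P.index m x)} ∆ P.base l)) ≤
      (((Finset.range (P.h m + 1)).filter p ∆ P.I l m).card : ℝ) / (P.I l m).card *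
        μ.real (P.base l) := by
  rw [P.measureReal_tower_inter_symmDiff_base hlm, P.card_div_mul_measureReal_base hlm]
  gcongr
  exact symmDiff_filter_range_subset_succ (P.I_subset l m) p

theorem card_div_mul_measureReal_base_le {l m : ℕ} (hlm : l ≤ m) (p : ℕ → Prop)
    [DecidablePred p] :
    (((Finset.range (P.h m + 1)).filter p ∆ P.I l m).card : ℝ) / (P.I l m).card *
        μ.real (P.base l) ≤
      μ.real (P.tower m ∩ ({x | p (P.index m x)} ∆ P.base l)) + μ.real (P.base m) := by
  rw [P.measureReal_tower_inter_symmDiff_base hlm, P.card_div_mul_measureReal_base hlm,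
    ← add_one_mul]
  gcongr
  exact_mod_cast card_symmDiff_filter_range_succ_le _ _ p

section Cyclic

variable {k : ℕ} {f : X → ZMod k}

theorem measureReal_levels_inter_ne_index (hf : T.IsCyclicFactorMap f) {n : ℕ} {S : Finset ℕ}
    (hS : S ⊆ Finset.range (P.h n)) (a : ℕ → ZMod k) :
    μ.real (P.levels n S ∩ {x | f x ≠ a (P.index n x)}) =
      ∑ i ∈ S, μ.real (P.base n ∩ {x | f x ≠ a i - i}) := by
  have hsplit : (P.levels n S ∩ {x | f x ≠ a (P.index n x)} : Set X) =ᵐ[μ]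
      ⋃ i ∈ S, P.level n i ∩ {x | f x ≠ a i} := by
    rw [eventuallyEq_set]
    filter_upwards [P.ae_index_eq n] with x hx
    simp only [Set.mem_inter_iff, mem_levels, Set.mem_iUnion₂, exists_prop, ← and_assoc,
      exists_and_right.symm]
    refine exists_congr fun i => and_congr_right fun hi => ?_
    rw [Set.mem_ofPred_eq, hx i (Finset.mem_range.1 (hS hi.1)) hi.2]
    rfl
  rw [measureReal_congr hsplit, measureReal_biUnion_finset₀]
  · simp only [P.measureReal_level_inter_ne hf]
  · intro i hi j hj hij
    exact (P.aedisjoint_level (Finset.mem_range.1 (hS hi)) (Finset.mem_range.1 (hS hj)) hij).mono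
      Set.inter_subset_left Set.inter_subset_left
  · exact fun i _ =>
      ((P.measurableSet_level n i).inter (hf.measurableSet_setOf (· ≠ a i))).nullMeasurableSet

theorem eventually_exists_measureReal_base_inter_ne_le [NeZero k] (hf : T.IsCyclicFactorMap f)
    {η : ℝ} (hη : 0 < η) :
    ∀ᶠ n in atTop, ∃ j, μ.real (P.base n ∩ {x | f x ≠ j}) ≤ η * μ.real (P.base n) := by
  filter_upwards [P.eventually_exists_measureReal_ne_index_lt hf.measurable (half_pos hη),
    P.tendsto_measureReal_tower.eventually (lt_mem_nhds one_half_lt_one)] with n ⟨a, ha⟩ htower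
  -- Otherwise every level contributes more than `η * μ(base n)` to the error of the approximation.
  by_contra! hspread
  have : η * μ.real (P.tower n) < η / 2 :=
    calc η * μ.real (P.tower n) = ∑ _ ∈ Finset.range (P.h n), η * μ.real (P.base n) := by
          rw [measureReal_tower, Finset.sum_const, Finset.card_range, nsmul_eq_mul]
          ring
      _ ≤ ∑ i ∈ Finset.range (P.h n), μ.real (P.base n ∩ {x | f x ≠ a i - i}) :=
          Finset.sum_le_sum fun i _ => (hspread _).le
      _ = μ.real (P.tower n ∩ {x | f x ≠ a (P.index n x)}) :=
          (P.measureReal_levels_inter_ne_index hf subset_rfl a).symm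
      _ ≤ μ.real {x | f x ≠ a (P.index n x)} := measureReal_mono Set.inter_subset_right
      _ < η / 2 := ha
  nlinarith

theorem measureReal_levels_inter_ne_index_add_le (hf : T.IsCyclicFactorMap f) {n : ℕ} {j : ZMod k}
    {δ : ℝ} (hj : μ.real (P.base n ∩ {x | f x ≠ j}) ≤ δ * μ.real (P.base n)) {S : Finset ℕ}
    (hS : S ⊆ Finset.range (P.h n)) :
    μ.real (P.levels n S ∩ {x | f x ≠ P.index n x + j}) ≤ δ * μ.real (P.levels n S) := by
  rw [P.measureReal_levels_inter_ne_index hf hS fun i => i + j, P.measureReal_levels hS]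
  simp only [add_sub_cancel_left]
  rw [Finset.sum_const, nsmul_eq_mul, mul_left_comm]
  exact mul_le_mul_of_nonneg_left hj (Nat.cast_nonneg _)

theorem eventually_exists_measureReal_ne_index_add_lt [NeZero k] (hf : T.IsCyclicFactorMap f)
    {δ : ℝ} (hδ : 0 < δ) :
    ∀ᶠ n in atTop, ∃ j : ZMod k, μ.real {x | f x ≠ P.index n x + j} < δ := by
  filter_upwards [P.eventually_exists_measureReal_base_inter_ne_le hf (half_pos hδ),
    P.tendsto_measureReal_compl_tower.eventually (gt_mem_nhds (half_pos hδ))] with n ⟨j, hj⟩ htower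
  refine ⟨j, ?_⟩
  calc μ.real {x | f x ≠ P.index n x + j}
      ≤ μ.real (P.tower n ∩ {x | f x ≠ P.index n x + j}) + μ.real (P.tower n)ᶜ :=
        (measureReal_mono fun x hx => (em (x ∈ P.tower n)).imp (⟨·, hx⟩) id).trans
          (measureReal_union_le _ _)
    _ ≤ δ / 2 * μ.real (P.tower n) + μ.real (P.tower n)ᶜ := by
        gcongr
        exact P.measureReal_levels_inter_ne_index_add_le hf hj subset_rfl
    _ ≤ δ / 2 + μ.real (P.tower n)ᶜ := by
        gcongr
        exact mul_le_of_le_one_right (half_pos hδ).le measureReal_le_one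
    _ < δ := by linarith

theorem residuesConcentrated_of_isCyclicFactorMap [NeZero k] (hf : T.IsCyclicFactorMap f) :
    P.ResiduesConcentrated k := by
  intro η hη
  obtain ⟨N, hN⟩ := eventually_atTop.1 (P.eventually_exists_measureReal_base_inter_ne_le hf
    (show 0 < η / 3 by positivity))
  refine ⟨N, fun m n hm hmn => ?_⟩
  obtain ⟨a, ha⟩ := hN m hm
  obtain ⟨b, hb⟩ := hN n (hm.trans hmn)
  refine ⟨a - b, ?_⟩
  set S := (P.I m n).filter fun i : ℕ => (i : ZMod k) ≠ a - b
  have hS_range : S ⊆ Finset.range (P.h n) := (Finset.filter_subset _ _).trans (P.I_subset m n)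
  have hcover : P.levels n S ≤ᵐ[μ] ((P.base m ∩ {x | f x ≠ a}) ∪
      (P.levels n (P.I m n) ∩ {x | f x ≠ P.index n x + b}) : Set X) := by
    filter_upwards [P.ae_mem_levels_iff n, (P.base_ae_eq_levels_I hmn).mem_iff] with x hx hbase hxS
    have hxI : x ∈ P.levels n (P.I m n) := P.levels_mono (Finset.filter_subset _ _) hxS
    have hres := (Finset.mem_filter.1 ((hx S hS_range).1 hxS).2).2
    by_cases hfa : f x = a
    · exact .inr ⟨hxI, fun hfb => hres (eq_sub_of_add_eq (hfb.symm.trans hfa))⟩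
    · exact .inl ⟨hbase.2 hxI, hfa⟩
  have hbase := P.measureReal_base_pos m
  refine lt_of_mul_lt_mul_right ?_ hbase.le
  calc (S.card : ℝ) / (P.I m n).card * μ.real (P.base m)
      = μ.real (P.levels n S) := by
        rw [P.card_div_mul_measureReal_base hmn, P.measureReal_levels hS_range]
    _ ≤ μ.real (P.base m ∩ {x | f x ≠ a}) +
          μ.real (P.levels n (P.I m n) ∩ {x | f x ≠ P.index n x + b}) :=
        (measureReal_mono_ae hcover).trans (measureReal_union_le _ _)
    _ ≤ η / 3 * μ.real (P.base m) + η / 3 * μ.real (P.levels n (P.I m n)) :=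
        add_le_add ha (P.measureReal_levels_inter_ne_index_add_le hf hb (P.I_subset m n))
    _ = 2 / 3 * (η * μ.real (P.base m)) := by
        rw [← measureReal_congr (P.base_ae_eq_levels_I hmn)]
        ring
    _ < η * μ.real (P.base m) := by
        have := mul_pos hη hbase
        linarith

theorem baseNearResidues_of_measureReal_symmDiff_lt [NeZero k] (hf : T.IsCyclicFactorMap f)
    {l : ℕ} {ε : ℝ} {D : Set (ZMod k)}
    (hD : μ.real (P.base l ∆ {x | f x ∈ D}) < ε * μ.real (P.base l)) :
    P.BaseNearResidues k l ε := by
  classical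
  obtain ⟨δ, hδ, hδ_eq⟩ : ∃ δ > 0, ε * μ.real (P.base l) =
      μ.real (P.base l ∆ {x | f x ∈ D}) + δ + δ := ⟨_, half_pos (sub_pos.2 hD), by ring⟩
  obtain ⟨N, hN⟩ := eventually_atTop.1 ((eventually_ge_atTop l).and
    ((P.eventually_exists_measureReal_ne_index_add_lt hf hδ).and
      (P.tendsto_measureReal_base.eventually (gt_mem_nhds hδ))))
  refine ⟨N, (hN N le_rfl).1, fun m hm => ?_⟩
  obtain ⟨hlm, ⟨j, hj⟩, hbase⟩ := hN m hm
  have hcover : P.tower m ∩ ({x | (P.index m x : ZMod k) + j ∈ D} ∆ P.base l) ⊆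
      P.base l ∆ {x | f x ∈ D} ∪ {x | f x ≠ P.index m x + j} := by
    rintro x ⟨-, hx⟩
    by_cases hfx : f x = P.index m x + j
    · rw [symmDiff_comm, Set.mem_symmDiff, Set.mem_ofPred_eq, ← hfx] at hx
      exact .inl hx
    · exact .inr hfx
  refine ⟨Finset.univ.filter (· + j ∈ D),
    lt_of_mul_lt_mul_right ?_ (P.measureReal_base_pos l).le⟩
  simp only [Finset.mem_filter_univ]
  refine (P.card_div_mul_measureReal_base_le hlm _).trans_lt ?_
  rw [hδ_eq]
  exact add_lt_add_of_le_of_lt ((measureReal_mono hcover).trans ((measureReal_union_le _ _).trans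
    (add_le_add_right hj.le _))) hbase

theorem exists_measureReal_symmDiff_lt_of_baseNearResidues [NeZero k]
    (hf : T.IsCyclicFactorMap f) {l : ℕ} {ε : ℝ}
    (h : P.BaseNearResidues k l ε) {δ : ℝ} (hδ : 0 < δ) :
    ∃ D : Set (ZMod k), μ.real (P.base l ∆ {x | f x ∈ D}) < ε * μ.real (P.base l) + δ := by
  obtain ⟨N, hlN, hN⟩ := h
  obtain ⟨m, hNm, ⟨j, hj⟩, htower⟩ := ((eventually_ge_atTop N).and
    ((P.eventually_exists_measureReal_ne_index_add_lt hf (half_pos hδ)).and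
      (P.tendsto_measureReal_compl_tower.eventually (gt_mem_nhds (half_pos hδ))))).exists
  obtain ⟨D, hD⟩ := hN m hNm
  refine ⟨{z | z - j ∈ D}, ?_⟩
  have hcover : P.base l ∆ {x | f x - j ∈ D} ⊆
      P.tower m ∩ ({x | (P.index m x : ZMod k) ∈ D} ∆ P.base l) ∪
        ((P.tower m)ᶜ ∪ {x | f x ≠ P.index m x + j}) := by
    intro x hx
    by_cases hfx : f x = P.index m x + j
    · by_cases hxt : x ∈ P.tower m
      · rw [symmDiff_comm, Set.mem_symmDiff, Set.mem_ofPred_eq, hfx, add_sub_cancel_right] at hx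
        exact .inl ⟨hxt, hx⟩
      · exact .inr (.inl hxt)
    · exact .inr (.inr hfx)
  have htower_inter := (P.measureReal_tower_inter_symmDiff_base_le (hlN.trans hNm)
    fun i => (i : ZMod k) ∈ D).trans_lt
      (mul_lt_mul_of_pos_right hD (P.measureReal_base_pos l))
  calc μ.real (P.base l ∆ {x | f x - j ∈ D})
      ≤ μ.real (P.tower m ∩ ({x | (P.index m x : ZMod k) ∈ D} ∆ P.base l)) +
          (μ.real (P.tower m)ᶜ + μ.real {x | f x ≠ P.index m x + j}) :=
        (measureReal_mono hcover).trans ((measureReal_union_le _ _).trans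
          (add_le_add_right (measureReal_union_le _ _) _))
    _ < ε * μ.real (P.base l) + δ := by linarith

end Cyclic

theorem eventuallyMeasurableSet_comap {Y : Type*} [mY : MeasurableSpace Y] {ν : Measure Y}
    {S : MPTransformation ν} {φ : X → Y} (hφ : T.IsFactorMap S φ)
    (hbase : ∀ n, EventuallyMeasurableSet (mY.comap φ) (ae μ) (P.base n)) {A : Set X}
    (hA : MeasurableSet A) : EventuallyMeasurableSet (mY.comap φ) (ae μ) A := by
  refine eventuallyMeasurableSet_of_approx fun ε hε => ?_
  obtain ⟨n, J, -, hAJ⟩ := P.exists_levels_approx hA hε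
  have hlevels : EventuallyMeasurableSet (mY.comap φ) (ae μ) (P.levels n J) :=
    Finset.measurableSet_biUnion (m := eventuallyMeasurableSpace (mY.comap φ) (ae μ)) J
      fun i _ => hφ.eventuallyMeasurableSet_image T (hbase n) i
  obtain ⟨G, hG, hGJ⟩ := hlevels
  exact ⟨G, hG, by rwa [← measureReal_congr ((ae_eq_refl A).symmDiff hGJ)]⟩

end RankOnePresentation

namespace OdometerSequence

variable (κ : OdometerSequence)

/-- The set of all points of the odometer whose `n`-th coordinate lies in `D`. -/
def cylinder (n : ℕ) (D : Set (ZMod (κ.k n))) : Set κ.space :=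
  (fun α => α.1 n) ⁻¹' D

/-- The algebra of all cylinders. -/
def cylinders : Set (Set κ.space) := {G | ∃ n D, G = κ.cylinder n D}

theorem measurable_coord (n : ℕ) : Measurable fun α : κ.space => α.1 n :=
  (measurable_pi_apply n).comp measurable_subtype_coe

theorem exists_cylinder_eq_of_le {m n : ℕ} (h : m ≤ n) (D : Set (ZMod (κ.k m))) :
    ∃ D' : Set (ZMod (κ.k n)), κ.cylinder m D = κ.cylinder n D' := by
  refine ⟨ZMod.castHom (κ.dvd h) (ZMod (κ.k m)) ⁻¹' D, ?_⟩
  ext α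
  simp only [cylinder, Set.mem_preimage]
  rw [α.2 m n h]

theorem isSetAlgebra_cylinders : IsSetAlgebra κ.cylinders where
  empty_mem := ⟨0, ∅, rfl⟩
  compl_mem := by
    rintro _ ⟨n, D, rfl⟩
    exact ⟨n, Dᶜ, rfl⟩
  union_mem := by
    rintro _ _ ⟨n, D, rfl⟩ ⟨n', D', rfl⟩
    obtain ⟨E, hE⟩ := κ.exists_cylinder_eq_of_le (le_max_left n n') D
    obtain ⟨E', hE'⟩ := κ.exists_cylinder_eq_of_le (le_max_right n n') D'
    exact ⟨max n n', E ∪ E', by rw [hE, hE']; rfl⟩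

theorem generateFrom_cylinders :
    (inferInstance : MeasurableSpace κ.space) = MeasurableSpace.generateFrom κ.cylinders := by
  refine le_antisymm ?_ (MeasurableSpace.generateFrom_le ?_)
  · refine measurable_iff_comap_le.1 ((@measurable_pi_iff _ _ _
      (MeasurableSpace.generateFrom κ.cylinders) _ Subtype.val).2 fun n D _ => ?_)
    exact MeasurableSpace.measurableSet_generateFrom ⟨n, D, rfl⟩
  · rintro _ ⟨n, D, rfl⟩
    exact κ.measurable_coord n MeasurableSet.of_discrete

theorem exists_cylinder_approx {G : Set κ.space} (hG : MeasurableSet G) {ε : ℝ} (hε : 0 < ε) :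
    ∃ n D, κ.measure.real (G ∆ κ.cylinder n D) < ε := by
  have hdense := Measure.MeasureDense.of_generateFrom_isSetAlgebra_finite κ.measure
    κ.isSetAlgebra_cylinders κ.generateFrom_cylinders
  obtain ⟨_, ⟨n, D, rfl⟩, hD⟩ := hdense.approx G hG (measure_ne_top _ _) ε hε
  exact ⟨n, D, (ENNReal.lt_ofReal_iff_toReal_lt (measure_ne_top _ _)).1 hD⟩

theorem isCyclicFactorMap_coord (n : ℕ) : κ.odometer.IsCyclicFactorMap fun α => α.1 n :=
  ⟨κ.measurable_coord n, .of_forall fun _ => rfl⟩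

variable {κ}

theorem ne_zero_of_mem_factors {k : ℕ} (hk : k ∈ κ.factors) : k ≠ 0 := by
  obtain ⟨n, hkn⟩ := hk
  exact ne_zero_of_dvd_ne_zero (NeZero.ne (κ.k n)) hkn

theorem exists_isCyclicFactorMap {k : ℕ} (hk : k ∈ κ.factors) :
    ∃ f : κ.space → ZMod k, κ.odometer.IsCyclicFactorMap f := by
  obtain ⟨n, hkn⟩ := hk
  exact ⟨_, (κ.isCyclicFactorMap_coord n).castHom hkn⟩

instance : SecondCountableTopology κ.space :=
  inferInstanceAs (SecondCountableTopology (κ.space : Set (∀ n, ZMod (κ.k n))))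

theorem coe_zsmul_one (z : ℤ) (n : ℕ) : (z • κ.one).1 n = z := by
  simp [one]

theorem exists_tendsto_zsmul_one {F : ℕ → ℤ}
    (hF : ∀ᶠ t in atTop, (F (t + 1) : ZMod (κ.k t)) = F t) :
    ∃ α : κ.space, Tendsto (fun t => F t • κ.one) atTop (𝓝 α) := by
  obtain ⟨t₀, ht₀⟩ := eventually_atTop.1 hF
  have hcast {m n : ℕ} (h : m ≤ n) (z : ℤ) :
      ZMod.castHom (κ.dvd h) (ZMod (κ.k m)) (z : ZMod (κ.k n)) = z := map_intCast _ z
  have hstable (n t : ℕ) (ht : max t₀ n ≤ t) : (F t : ZMod (κ.k n)) = F (max t₀ n) := by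
    induction t, ht using Nat.le_induction with
    | base => rfl
    | succ t ht ih =>
      have hnt : n ≤ t := (le_max_right _ _).trans ht
      rw [← ih, ← hcast hnt, ht₀ t ((le_max_left _ _).trans ht), hcast hnt]
  refine ⟨⟨fun n => F (max t₀ n), fun m n h => ?_⟩, ?_⟩
  · rw [hcast h]
    exact hstable m _ (max_le_max le_rfl h)
  · rw [tendsto_subtype_rng, tendsto_pi_nhds]
    refine fun n => tendsto_const_nhds.congr' ?_
    filter_upwards [eventually_ge_atTop (max t₀ n)] with t ht
    exact ((coe_zsmul_one (F t) n).trans (hstable n t ht)).symm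

variable {X : Type*} [MeasurableSpace X] {μ : Measure X} [IsProbabilityMeasure μ]
  {T : MPTransformation μ}

theorem isFactorMap_of_equivariant {φ : X → κ.space} (hφ : Measurable φ)
    (hT : ∀ᵐ x ∂μ, φ (T.toFun x) = φ x + κ.one) : T.IsFactorMap κ.odometer φ := by
  have hcyclic (n : ℕ) : T.IsCyclicFactorMap fun x => (φ x).1 n :=
    ⟨(κ.measurable_coord n).comp hφ, hT.mono fun x hx => congrArg (fun α => α.1 n) hx⟩
  have hcoord (n : ℕ) : (μ.map φ).map (fun α : κ.space => α.1 n) =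
      κ.measure.map (fun α : κ.space => α.1 n) := by
    rw [Measure.map_map (κ.measurable_coord n) hφ]
    refine Measure.ext_of_singleton fun i => ?_
    rw [Measure.map_apply ((κ.measurable_coord n).comp hφ) (measurableSet_singleton i),
      Measure.map_apply (κ.measurable_coord n) (measurableSet_singleton i)]
    exact ((hcyclic n).measure_preimage_singleton i).trans (κ.measure_cylinder n i).symm
  have : IsProbabilityMeasure (μ.map φ) := Measure.isProbabilityMeasure_map hφ.aemeasurable
  refine ⟨⟨hφ, ext_of_generate_finite κ.cylinders κ.generateFrom_cylinders
    κ.isSetAlgebra_cylinders.isSetRing.isSetSemiring.isPiSystem ?_ (by simp)⟩, hT⟩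
  rintro _ ⟨n, D, rfl⟩
  have hD := DFunLike.congr_fun (hcoord n) D
  rwa [Measure.map_apply (κ.measurable_coord n) MeasurableSet.of_discrete,
    Measure.map_apply (κ.measurable_coord n) MeasurableSet.of_discrete] at hD

theorem exists_isFactorMap_of_ae_eventually {F : ℕ → X → ℤ} (hF : ∀ t, Measurable (F t))
    (hcompat : ∀ᵐ x ∂μ, ∀ᶠ t in atTop, (F (t + 1) x : ZMod (κ.k t)) = F t x)
    (hequi : ∀ᵐ x ∂μ, ∀ᶠ t in atTop, F t (T.toFun x) = F t x + 1) :
    ∃ φ : X → κ.space, T.IsFactorMap κ.odometer φ := by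
  obtain ⟨φ, hφ, hlim⟩ := measurable_limit_of_tendsto_metrizable_ae (μ := μ) (L := atTop)
    (f := fun t x => F t x • κ.one)
    (fun t => ((Measurable.of_discrete (f := (· • κ.one))).comp (hF t)).aemeasurable)
    (hcompat.mono fun x hx => exists_tendsto_zsmul_one hx)
  refine ⟨φ, isFactorMap_of_equivariant hφ ?_⟩
  filter_upwards [hlim, T.measurePreserving.quasiMeasurePreserving.ae hlim, hequi]
    with x hx hTx hstep
  refine tendsto_nhds_unique hTx ((hx.add_const κ.one).congr' (hstep.mono fun t ht => ?_))
  simp only [ht, add_one_zsmul]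

theorem exists_isFactorMap_of_cauchy {g : ℕ → X → ℤ} (hg : ∀ n, Measurable (g n))
    (hstep : Tendsto (fun n => μ.real {x | g n (T.toFun x) ≠ g n x + 1}) atTop (𝓝 0))
    (hcauchy : ∀ t, ∀ η : ℝ, 0 < η → ∃ N, ∀ m n, N ≤ m → m ≤ n → ∃ j : ZMod (κ.k t),
      μ.real {x | (g n x : ZMod (κ.k t)) ≠ g m x + j} < η) :
    ∃ φ : X → κ.space, T.IsFactorMap κ.odometer φ := by
  have hfast (t : ℕ) : ∀ᶠ m in atTop,
      μ.real {x | g m (T.toFun x) ≠ g m x + 1} < (1 / 2) ^ t ∧ ∀ n ≥ m, ∃ j : ZMod (κ.k t),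
        μ.real {x | (g n x : ZMod (κ.k t)) ≠ g m x + j} < (1 / 2) ^ t := by
    have hpos : (0 : ℝ) < (1 / 2) ^ t := by positivity
    obtain ⟨N, hN⟩ := hcauchy t _ hpos
    filter_upwards [hstep.eventually (gt_mem_nhds hpos), eventually_ge_atTop N]
      with m hm hNm
    exact ⟨hm, fun n => hN m n hNm⟩
  obtain ⟨m, hm, hfast⟩ := extraction_forall_of_eventually hfast
  choose j hj using fun t => (hfast t).2 (m (t + 1)) (hm.monotone t.le_succ)
  -- Subtracting the accumulated translations makes the subsequence converge in each coordinate.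
  let c (t : ℕ) : ℤ := ∑ u ∈ Finset.range t, ((j u).val : ℤ)
  have hc (t : ℕ) : (c (t + 1) : ZMod (κ.k t)) = c t + j t := by
    simp [c, Finset.sum_range_succ]
  refine exists_isFactorMap_of_ae_eventually (F := fun t x => g (m t) x - c t)
    (fun t => (hg (m t)).sub_const (c t)) ?_ ?_
  · filter_upwards [ae_eventually_notMem_of_measureReal_le_geometric fun t => (hj t).le] with x hx
    filter_upwards [hx] with t ht
    rw [Int.cast_sub, Int.cast_sub, hc, not_not.1 ht]
    ring
  · filter_upwards [ae_eventually_notMem_of_measureReal_le_geometric fun t => (hfast t).1.le]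
      with x hx
    filter_upwards [hx] with t ht
    rw [not_not.1 ht]
    ring

end OdometerSequence

namespace RankOnePresentation

open scoped Pointwise

variable {X : Type*} [MeasurableSpace X] {μ : Measure X} {T : MPTransformation μ}
  (P : RankOnePresentation T)

variable [IsProbabilityMeasure μ]

theorem measureReal_index_toFun_ne_le (n : ℕ) :
    μ.real {x | P.index n (T.toFun x) ≠ P.index n x + 1} ≤
      μ.real (P.tower n)ᶜ + μ.real (P.base n) := by
  rw [← P.measureReal_level n (P.h n - 1)]
  refine (measureReal_mono_ae ?_).trans (measureReal_union_le _ _)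
  filter_upwards [T.left_inv, P.ae_index_eq n,
    T.measurePreserving.quasiMeasurePreserving.ae (P.ae_index_eq n)] with x hinv hx hTx hne
  by_contra hgood
  obtain ⟨hxt, hxtop⟩ := not_or.1 hgood
  obtain ⟨i, hi, hxi⟩ := P.mem_levels.1 (Set.notMem_compl_iff.1 hxt)
  rw [Finset.mem_range] at hi
  have htop : i ≠ P.h n - 1 := fun h => hxtop (h ▸ hxi)
  have hTxi : T.toFun x ∈ P.level n (i + 1) := by
    simpa only [level, MPTransformation.image, Set.mem_preimage, Function.iterate_succ_apply, hinv]
      using hxi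
  exact hne (by rw [hx i hi hxi, hTx (i + 1) (by omega) hTxi])

theorem tendsto_measureReal_index_toFun_ne :
    Tendsto (fun n => μ.real {x | P.index n (T.toFun x) ≠ P.index n x + 1}) atTop (𝓝 0) :=
  squeeze_zero (fun _ => measureReal_nonneg) P.measureReal_index_toFun_ne_le
    (by simpa only [add_zero] using
      P.tendsto_measureReal_compl_tower.add P.tendsto_measureReal_base)

theorem ae_exists_index_eq_add {m n : ℕ} (hmn : m ≤ n) :
    ∀ᵐ x ∂μ, x ∈ P.tower m → ∃ c ∈ P.I m n, P.index n x = P.index m x + c := by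
  filter_upwards [P.ae_index_eq m, P.ae_index_eq n, ae_all_iff.2 fun i =>
    (T.image_ae_congr i (P.base_ae_eq_levels_I hmn)).mem_iff] with x hxm hxn hbase hxt
  obtain ⟨i, hi, hxi⟩ := P.mem_levels.1 hxt
  rw [Finset.mem_range] at hi
  obtain ⟨c, hc, hxc⟩ := P.mem_levels.1 ((hbase i).1 hxi)
  have hxic : x ∈ P.level n (i + c) := by
    rw [level_add]
    exact hxc
  have := P.add_h_le_of_mem_I hmn hc
  exact ⟨c, hc, by rw [hxm i hi hxi, hxn (i + c) (by omega) hxic]⟩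

theorem measureReal_index_ne_index_add_le {m n k : ℕ} (hmn : m ≤ n) (j : ZMod k) :
    μ.real {x | (P.index n x : ZMod k) ≠ P.index m x + j} ≤ μ.real (P.tower m)ᶜ +
      (((P.I m n).filter fun i : ℕ => (i : ZMod k) ≠ j).card : ℝ) / (P.I m n).card := by
  set bad := (P.I m n).filter fun i : ℕ => (i : ZMod k) ≠ j
  have hcopies : Finset.range (P.h m) + bad ⊆ Finset.range (P.h n) := fun c hc => by
    obtain ⟨i, hi, b, hb, rfl⟩ := Finset.mem_add.1 hc
    have := P.add_h_le_of_mem_I hmn (Finset.mem_filter.1 hb).1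
    rw [Finset.mem_range] at hi ⊢
    omega
  have hcover : {x | (P.index n x : ZMod k) ≠ P.index m x + j} ≤ᵐ[μ]
      ((P.tower m)ᶜ ∪ P.levels n (Finset.range (P.h m) + bad) : Set X) := by
    filter_upwards [P.ae_exists_index_eq_add hmn, P.ae_mem_levels_iff m, P.ae_mem_levels_iff n,
      P.ae_le_tower_of_le hmn] with x hadd hxm hxn htower hne
    refine or_iff_not_imp_left.2 fun hxt => (hxn _ hcopies).2 ?_
    have hxt : x ∈ P.tower m := Set.notMem_compl_iff.1 hxt
    obtain ⟨c, hc, hindex⟩ := hadd hxt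
    have hcj : (c : ZMod k) ≠ j := fun h => hne (by rw [hindex, Nat.cast_add, h])
    refine ⟨htower hxt, hindex ▸ Finset.add_mem_add ((hxm _ subset_rfl).1 hxt).2 ?_⟩
    exact Finset.mem_filter.2 ⟨hc, hcj⟩
  refine (measureReal_mono_ae hcover).trans ((measureReal_union_le _ _).trans ?_)
  gcongr
  calc μ.real (P.levels n (Finset.range (P.h m) + bad))
      = (Finset.range (P.h m) + bad).card * μ.real (P.base n) := P.measureReal_levels hcopies
    _ ≤ P.h m * bad.card * μ.real (P.base n) := by
        gcongr
        exact_mod_cast Finset.card_add_le.trans_eq (by rw [Finset.card_range])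
    _ = bad.card / (P.I m n).card * μ.real (P.tower m) := by
        rw [mul_assoc, ← P.card_div_mul_measureReal_base hmn, measureReal_tower, mul_left_comm]
    _ ≤ bad.card / (P.I m n).card := mul_le_of_le_one_right (by positivity) measureReal_le_one

theorem ResiduesConcentrated.exists_measureReal_index_ne_index_add_lt {k : ℕ}
    (h : P.ResiduesConcentrated k) {η : ℝ} (hη : 0 < η) :
    ∃ N, ∀ m n, N ≤ m → m ≤ n → ∃ j : ZMod k,
      μ.real {x | (P.index n x : ZMod k) ≠ P.index m x + j} < η := by
  obtain ⟨N, hN⟩ := h (η / 2) (half_pos hη)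
  obtain ⟨N', hN'⟩ := eventually_atTop.1
    (P.tendsto_measureReal_compl_tower.eventually (gt_mem_nhds (half_pos hη)))
  refine ⟨max N N', fun m n hm hmn => ?_⟩
  obtain ⟨j, hj⟩ := hN m n (le_of_max_le_left hm) hmn
  refine ⟨j, (P.measureReal_index_ne_index_add_le hmn j).trans_lt ?_⟩
  exact (add_lt_add (hN' m (le_of_max_le_right hm)) hj).trans_eq (add_halves η)

theorem exists_isFactorMap_odometer {κ : OdometerSequence}
    (h : ∀ k ∈ κ.factors, P.ResiduesConcentrated k) :
    ∃ φ : X → κ.space, T.IsFactorMap κ.odometer φ := by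
  refine OdometerSequence.exists_isFactorMap_of_cauchy (g := fun n x => (P.index n x : ℤ))
    (fun n => Measurable.of_discrete.comp (P.measurable_index n)) ?_ fun t η hη => ?_
  · exact_mod_cast P.tendsto_measureReal_index_toFun_ne
  · simpa only [Int.cast_natCast] using
      (h (κ.k t) ⟨t, dvd_rfl⟩).exists_measureReal_index_ne_index_add_lt P hη

theorem eventuallyMeasurableSet_base_comap {κ : OdometerSequence} {φ : X → κ.space}
    (hφ : T.IsFactorMap κ.odometer φ) {l : ℕ}
    (h : ∀ ε : ℝ, 0 < ε → ∃ k ∈ κ.factors, P.BaseNearResidues k l ε) :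
    EventuallyMeasurableSet (MeasurableSpace.comap φ inferInstance) (ae μ) (P.base l) := by
  refine eventuallyMeasurableSet_of_approx fun ε hε => ?_
  obtain ⟨k, hk, hbase⟩ := h (ε / 2) (half_pos hε)
  have : NeZero k := ⟨OdometerSequence.ne_zero_of_mem_factors hk⟩
  obtain ⟨f, hf⟩ := OdometerSequence.exists_isCyclicFactorMap hk
  obtain ⟨D, hD⟩ :=
    P.exists_measureReal_symmDiff_lt_of_baseNearResidues (hf.comp hφ) hbase (half_pos hε)
  refine ⟨φ ⁻¹' (f ⁻¹' D), ⟨_, hf.measurableSet_setOf (· ∈ D), rfl⟩, hD.trans_le ?_⟩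
  have := mul_le_of_le_one_right (half_pos hε).le (measureReal_le_one (μ := μ) (s := P.base l))
  linarith

theorem isomorphic_odometer [StandardBorelSpace X] {κ : OdometerSequence}
    (hres : ∀ k ∈ κ.factors, P.ResiduesConcentrated k)
    (hbase : ∀ l, ∀ ε : ℝ, 0 < ε → ∃ k ∈ κ.factors, P.BaseNearResidues k l ε) :
    T.Isomorphic κ.odometer := by
  have : Nonempty X := nonempty_of_isProbabilityMeasure μ
  obtain ⟨φ, hφ⟩ := P.exists_isFactorMap_odometer hres
  obtain ⟨ψ, hψ⟩ := exists_ae_inverse_of_eventuallyMeasurableSet hφ.1 fun A hA =>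
    P.eventuallyMeasurableSet_comap hφ
      (fun l => P.eventuallyMeasurableSet_base_comap hφ (hbase l)) hA
  exact ⟨φ, ψ, hφ, hψ⟩

theorem residuesConcentrated_of_isFactorMap {κ : OdometerSequence} {φ : X → κ.space}
    (hφ : T.IsFactorMap κ.odometer φ) {k : ℕ} (hk : k ∈ κ.factors) : P.ResiduesConcentrated k := by
  have : NeZero k := ⟨OdometerSequence.ne_zero_of_mem_factors hk⟩
  obtain ⟨f, hf⟩ := OdometerSequence.exists_isCyclicFactorMap hk
  exact P.residuesConcentrated_of_isCyclicFactorMap (hf.comp hφ)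

theorem exists_baseNearResidues_of_isomorphic {κ : OdometerSequence}
    (h : T.Isomorphic κ.odometer) (l : ℕ) {ε : ℝ} (hε : 0 < ε) :
    ∃ k ∈ κ.factors, P.BaseNearResidues k l ε := by
  obtain ⟨φ, ψ, hφ, hψ, hψφ, -⟩ := h
  have hG : MeasurableSet (ψ ⁻¹' P.base l) := hψ.measurable (P.measurableSet_base l)
  obtain ⟨n, D, hD⟩ :=
    κ.exists_cylinder_approx hG (mul_pos hε (P.measureReal_base_pos l))
  refine ⟨κ.k n, ⟨n, dvd_rfl⟩, P.baseNearResidues_of_measureReal_symmDiff_lt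
    ((κ.isCyclicFactorMap_coord n).comp hφ) (D := D) ?_⟩
  have hcyl : MeasurableSet (κ.cylinder n D) := κ.measurable_coord n MeasurableSet.of_discrete
  rw [← hφ.1.measureReal_preimage (hG.symmDiff hcyl).nullMeasurableSet] at hD
  refine (measureReal_congr (eventuallyEq_set.2 (hψφ.mono fun x hx => ?_))).trans_lt hD
  simp only [OdometerSequence.cylinder, Set.mem_symmDiff, Set.mem_preimage, hx, Set.mem_ofPred_eq,
    Function.comp_apply]

end RankOnePresentation

theorem mainTheorem1 {X : Type*} [MeasurableSpace X] [StandardBorelSpace X]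
    (μ : Measure X) [IsProbabilityMeasure μ] [NullSingletonClass μ]
    (T : MPTransformation μ) (P : RankOnePresentation T)
    (K : Set ℕ) (hK : K.Infinite) (κ : OdometerSequence) (hκ : K = κ.factors) :
    T.Isomorphic κ.odometer ↔
      (∀ k ∈ K, ∀ η : ℝ, 0 < η → ∃ N : ℕ, ∀ m n : ℕ, N ≤ m → m ≤ n → ∃ j : ZMod k,
        (((P.I m n).filter (fun i : ℕ => (i : ZMod k) ≠ j)).card : ℝ) /
          ((P.I m n).card : ℝ) < η) ∧
      (∀ l : ℕ, ∀ ε : ℝ, 0 < ε → ∃ k ∈ K, ∃ N : ℕ, l ≤ N ∧ ∀ m : ℕ, N ≤ m →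
        ∃ D : Finset (ZMod k),
          ((((Finset.range (P.h m + 1)).filter (fun i : ℕ => (i : ZMod k) ∈ D)) ∆
              P.I l m).card : ℝ) /
            ((P.I l m).card : ℝ) < ε) := by
  subst hκ
  constructor
  · intro hiso
    have ⟨φ, _, hφ, _⟩ := hiso
    exact ⟨fun k hk => P.residuesConcentrated_of_isFactorMap hφ hk,
      fun l ε hε => P.exists_baseNearResidues_of_isomorphic hiso l hε⟩
  · rintro ⟨hres, hbase⟩
    exact P.isomorphic_odometer hres hbase
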